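/- A sign vector on a finite set $E$ is a map $X:E\to\{0,+,-\}$, with support $\operatorname{supp}(X)=\{e: X_e\ne 0\}$. The composition $X\circ Y$ has $(X\circ Y)_e=X_e$ if $X_e\neq 0$ and $(X\circ Y)_e=Y_e$ otherwise; the separation set $\operatorname{Sep}(X,Y)$ is the set of $e$ with $X_e=-Y_e\ne 0$. Let $\mathcal{O}$ be an oriented matroid on $E$, given by its set of covectors: a set of sign vectors on $E$ that contains $0$, is closed under negation and under composition, and is such that for all $X,Y\in\mathcal{O}$ and $e\in \operatorname{Sep}(X,Y)$ there is $Z\in\mathcal{O}$ with $Z_e=0$ and $Z_f=(X\circ Y)_f$ for all $f\notin\operatorname{Sep}(X,Y)$. The dual $\mathcal{O}^\ast$ is the oriented matroid whose covectors are the vectors of $\mathcal{O}$, i.e. the sign vectors $X$ orthogonal to every $Y\in\mathcal{O}$ (the products $X_eY_e$, $e\in E$, are all $0$, or both $+$ and $-$ occur among them). $\mathcal{O}$ is totally cyclic if the all-$+$ vector lies in $\mathcal{O}^\ast$. For $S\subseteq E$, the contraction $\mathcal{O}/S$ is the oriented matroid on $E\setminus S$ whose covectors are the restrictions to $E\setminus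 S$ of those $Y\in\mathcal{O}$ that vanish on $S$. $S$ is a dijoin if $\operatorname{supp}(Y)\cap S\neq\emptyset$ for every $Y\in\mathcal{O}\setminus\{0\}$ with all entries in $\{0,+\}$. A cocircuit is a nonzero covector of inclusion-minimal support; it is positive if it has no entry $-$. **Proposition.** Let $\mathcal{O}$ be an oriented matroid on a finite set $E$ and let $S\subseteq E$. Then $S$ is a dijoin if and only if $\mathcal{O}/S$ is totally cyclic. Likewise, $S$ meets (the support of) every positive cocircuit of $\mathcal{O}$ if and only if $\mathcal{O}/S$ is totally cyclic. -/

import Mathlib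

/-- Composition of sign vectors: `(X ∘ Y) e = X e` if `X e ≠ 0`, and `Y e` otherwise. -/
def signComp {E : Type*} (X Y : E → SignType) : E → SignType :=
  fun e => if X e = 0 then Y e else X e

/-- The separation set of `X` and `Y`: the elements where they have opposite nonzero signs. -/
def signSep {E : Type*} (X Y : E → SignType) : Set E :=
  {e | X e ≠ 0 ∧ X e = - Y e}

/-- Orthogonality of sign vectors: the entrywise products are all zero, or both signs occur
among them. -/
def SignOrth {E : Type*} (X Y : E → SignType) : Prop :=
  (∀ e, X e * Y e = 0) ∨ ((∃ e, X e * Y e = 1) ∧ ∃ e, X e * Y e = -1)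

/-- An oriented matroid on the ground set `E`, given by its set of covectors. -/
structure OrientedMatroid (E : Type*) where
  covectors : Set (E → SignType)
  zero_mem : (0 : E → SignType) ∈ covectors
  neg_mem : ∀ X ∈ covectors, -X ∈ covectors
  comp_mem : ∀ X ∈ covectors, ∀ Y ∈ covectors, signComp X Y ∈ covectors
  elim : ∀ X ∈ covectors, ∀ Y ∈ covectors, ∀ e ∈ signSep X Y,
    ∃ Z ∈ covectors, Z e = 0 ∧ ∀ f, f ∉ signSep X Y → Z f = signComp X Y f

namespace OrientedMatroid

theorem signOrth_iff {E : Type*} (X Y : E → SignType) :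
    SignOrth X Y ↔
      ((∀ e, 0 ≤ X e * Y e) → ∀ e, X e * Y e = 0) ∧
      ((∀ e, 0 ≤ X e * (-Y) e) → ∀ e, X e * (-Y) e = 0) := by
  have key : ∀ a b : SignType, (0 ≤ a * b ↔ a * b ≠ -1) ∧ (0 ≤ a * -b ↔ a * b ≠ 1) ∧
      (a * -b = 0 ↔ a * b = 0) ∧ (a * b = 0 ∨ a * b = 1 ∨ a * b = -1) := by decide
  have h01 : (0 : SignType) ≠ 1 := by decide
  have h02 : (0 : SignType) ≠ -1 := by decide
  simp only [Pi.neg_apply, fun e => (key (X e) (Y e)).1, fun e => (key (X e) (Y e)).2.1,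
    fun e => (key (X e) (Y e)).2.2.1]
  constructor
  · rintro (h | ⟨⟨e, he⟩, ⟨f, hf⟩⟩)
    · exact ⟨fun _ => h, fun _ => h⟩
    · exact ⟨fun h => absurd hf (h f), fun h => absurd he (h e)⟩
  · rintro ⟨h1, h2⟩
    by_cases hz : ∀ e, X e * Y e = 0
    · exact Or.inl hz
    · refine Or.inr ⟨?_, ?_⟩
      · by_contra hc
        exact hz (h2 fun e he => hc ⟨e, he⟩)
      · by_contra hc
        exact hz (h1 fun e he => hc ⟨e, he⟩)

/-- Since covectors are closed under negation, only products of one sign need be excluded. -/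
theorem orth_covectors_iff {E : Type*} (O : OrientedMatroid E) (X : E → SignType)
    (A : Set E) :
    (∀ Y ∈ O.covectors, (∀ a ∈ A, Y a = 0) → SignOrth X Y) ↔
      ∀ Y ∈ O.covectors, (∀ a ∈ A, Y a = 0) → (∀ e, 0 ≤ X e * Y e) → ∀ e, X e * Y e = 0 := by
  constructor
  · intro h Y hY hA
    exact ((signOrth_iff X Y).1 (h Y hY hA)).1
  · intro h Y hY hA
    refine (signOrth_iff X Y).2 ⟨h Y hY hA, h (-Y) (O.neg_mem Y hY) ?_⟩
    intro a ha
    simp [hA a ha]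

/-- A sign vector that is orthogonal to all covectors vanishing on `A` can be changed on `A` so
as to become orthogonal to all covectors. -/
theorem exists_orth_extension {E : Type*} (O : OrientedMatroid E) (A : Set E) (hA : A.Finite) :
    ∀ σ : E → SignType, (∀ Y ∈ O.covectors, (∀ a ∈ A, Y a = 0) → SignOrth σ Y) →
      ∃ Z : E → SignType, (∀ Y ∈ O.covectors, SignOrth Z Y) ∧ ∀ f, f ∉ A → Z f = σ f := by
  classical
  induction A, hA using Set.Finite.induction_on with
  | empty => exact fun σ h => ⟨σ, fun Y hY => h Y hY (by simp), fun _ _ => rfl⟩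
  | @insert a A _ _ ih =>
    intro σ h
    suffices hs : ∃ s : SignType, ∀ Y ∈ O.covectors, (∀ b ∈ A, Y b = 0) →
        SignOrth (Function.update σ a s) Y by
      obtain ⟨s, hs⟩ := hs
      obtain ⟨Z, hZ, hZA⟩ := ih _ hs
      refine ⟨Z, hZ, fun f hf => ?_⟩
      rw [Set.mem_insert_iff, not_or] at hf
      rw [hZA f hf.2, Function.update_of_ne hf.1]
    simp only [orth_covectors_iff] at h ⊢
    by_contra hc
    push Not at hc
    have hval : ∀ (s : SignType) (Y : E → SignType), (∀ e, 0 ≤ Function.update σ a s e * Y e) →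
        (∀ e, e ≠ a → 0 ≤ σ e * Y e) ∧ 0 ≤ s * Y a := by
      intro s Y hY
      refine ⟨fun e he => ?_, ?_⟩
      · simpa [Function.update_of_ne he] using hY e
      · simpa using hY a
    have hne : ∀ (s : SignType) (Y : E → SignType), Y ∈ O.covectors → (∀ b ∈ A, Y b = 0) →
        (∀ e, 0 ≤ Function.update σ a s e * Y e) →
        (∃ e, Function.update σ a s e * Y e ≠ 0) → Y a ≠ 0 := by
      intro s Y hY hYA hpos hnz h0
      obtain ⟨e, he⟩ := hnz
      have hea : e ≠ a := by
        rintro rfl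
        simp [h0] at he
      rw [Function.update_of_ne hea] at he
      refine he (h Y hY ?_ ?_ e)
      · intro b hb
        rcases hb with rfl | hb
        · exact h0
        · exact hYA b hb
      · intro f
        by_cases hf : f = a
        · subst hf
          simp [h0]
        · exact (hval s Y hpos).1 f hf
    obtain ⟨Y1, hY1, hY1A, hp1, e1, he1⟩ := hc 0
    have ha1 := hne 0 Y1 hY1 hY1A hp1 ⟨e1, he1⟩
    obtain ⟨Y2, hY2, hY2A, hp2, hn2⟩ := hc (-(Y1 a))
    have ha2 := hne _ Y2 hY2 hY2A hp2 hn2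
    have he1a : e1 ≠ a := by
      rintro rfl
      simp at he1
    rw [Function.update_of_ne he1a] at he1
    have hsep : a ∈ signSep Y1 Y2 := by
      refine ⟨ha1, ?_⟩
      have := (hval _ Y2 hp2).2
      revert this ha1 ha2
      generalize Y1 a = u
      generalize Y2 a = v
      revert u v
      decide
    obtain ⟨W, hW, hWa, hWf⟩ := O.elim Y1 hY1 Y2 hY2 a hsep
    have hnotsep : ∀ f, f ≠ a → σ f ≠ 0 → W f = signComp Y1 Y2 f := by
      intro f hf hσ
      refine hWf f ?_
      rintro ⟨h1, h2⟩
      have q1 := (hval _ Y1 hp1).1 f hf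
      have q2 := (hval _ Y2 hp2).1 f hf
      revert h1 h2 q1 q2 hσ
      generalize Y1 f = u
      generalize Y2 f = v
      generalize σ f = w
      revert u v w
      decide
    have hσ1 : σ e1 ≠ 0 := fun h0 => he1 (by rw [h0, zero_mul])
    have hY1e : Y1 e1 ≠ 0 := fun h0 => he1 (by rw [h0, mul_zero])
    have hfin := h W hW ?_ ?_ e1
    · rw [hnotsep e1 he1a hσ1, signComp, if_neg hY1e] at hfin
      exact he1 hfin
    · intro b hb
      rcases hb with rfl | hb
      · exact hWa
      · rw [hWf b (fun hs => hs.1 (hY1A b hb)), signComp, if_pos (hY1A b hb), hY2A b hb]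
    · intro f
      by_cases hf : f = a
      · subst hf
        simp [hWa]
      · by_cases hσ : σ f = 0
        · simp [hσ]
        · rw [hnotsep f hf hσ, signComp]
          split_ifs
          · exact (hval _ Y2 hp2).1 f hf
          · exact (hval _ Y1 hp1).1 f hf

/-- The dual oriented matroid `O*`: its covectors (the vectors of `O`) are the sign vectors
orthogonal to every covector of `O`. -/
def dual {E : Type*} [Finite E] (O : OrientedMatroid E) : OrientedMatroid E where
  covectors := {X | ∀ Y ∈ O.covectors, SignOrth X Y}
  zero_mem := fun Y _ => Or.inl fun e => by simp
  neg_mem := by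
    intro X hX Y hY
    rcases hX Y hY with h | ⟨⟨e, he⟩, ⟨f, hf⟩⟩
    · exact Or.inl fun e => by simp [h e]
    · exact Or.inr ⟨⟨f, by simp [hf]⟩, ⟨e, by simp [he]⟩⟩
  comp_mem := by
    intro X hX X' hX' Y hY
    by_cases h0 : ∀ e, X e * Y e = 0
    · have hc : ∀ e, X' e * Y e ≠ 0 → X e = 0 := by
        intro e he
        rcases mul_eq_zero.1 (h0 e) with h | h
        · exact h
        · simp [h] at he
      rcases hX' Y hY with h | ⟨⟨e, he⟩, ⟨f, hf⟩⟩
      · refine Or.inl fun e => ?_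
        unfold signComp
        split_ifs
        · exact h e
        · exact h0 e
      · refine Or.inr ⟨⟨e, ?_⟩, ⟨f, ?_⟩⟩
        · rw [signComp, if_pos (hc e (by rw [he]; decide)), he]
        · rw [signComp, if_pos (hc f (by rw [hf]; decide)), hf]
    · rcases hX Y hY with h | ⟨⟨e, he⟩, ⟨f, hf⟩⟩
      · exact absurd h h0
      · refine Or.inr ⟨⟨e, ?_⟩, ⟨f, ?_⟩⟩
        · have : X e ≠ 0 := fun h => by simp [h] at he
          rw [signComp, if_neg this, he]
        · have : X f ≠ 0 := fun h => by simp [h] at hf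
          rw [signComp, if_neg this, hf]
  elim := by
    classical
    intro X hX X' hX' e he
    have hX0 := (orth_covectors_iff O X ∅).1 fun Y hY _ => hX Y hY
    have hX0' := (orth_covectors_iff O X' ∅).1 fun Y hY _ => hX' Y hY
    obtain ⟨Z, hZ, hZf⟩ := exists_orth_extension O (signSep X X' \ {e}) (Set.toFinite _)
      (Function.update (signComp X X') e 0) (by
        rw [orth_covectors_iff]
        intro Y hY hYA hpos
        have hoff : ∀ f, f ∉ signSep X X' → 0 ≤ X f * Y f ∧ 0 ≤ X' f * Y f := by
          intro f hf
          have hfe : f ≠ e := fun h => hf (h ▸ he)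
          have := hpos f
          rw [Function.update_of_ne hfe] at this
          revert hf this
          simp only [signComp, signSep, Set.mem_ofPred_eq]
          generalize X f = u
          generalize X' f = v
          generalize Y f = w
          revert u v w
          decide
        have hon : ∀ f, f ≠ e → f ∈ signSep X X' → Y f = 0 := fun f hf hs => hYA f ⟨hs, hf⟩
        have hall : ∀ V : E → SignType, (∀ f, f ∉ signSep X X' → 0 ≤ V f * Y f) →
            0 ≤ V e * Y e → ∀ f, 0 ≤ V f * Y f := by
          intro V hV hVe f
          by_cases hf : f = e
          · exact hf ▸ hVe
          · by_cases hs : f ∈ signSep X X'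
            · simp [hon f hf hs]
            · exact hV f hs
        have hYe : Y e = 0 := by
          by_contra hYe
          have hcase : X e * Y e = 1 ∨ X' e * Y e = 1 := by
            obtain ⟨h1, h2⟩ := he
            revert h1 h2 hYe
            generalize X e = u
            generalize X' e = v
            generalize Y e = w
            revert u v w
            decide
          rcases hcase with h | h
          · have := hX0 Y hY (by simp) (hall X (fun f hf => (hoff f hf).1) (by rw [h]; decide)) e
            rw [h] at this
            exact absurd this (by decide)
          · have := hX0' Y hY (by simp) (hall X' (fun f hf => (hoff f hf).2) (by rw [h]; decide)) e
            rw [h] at this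
            exact absurd this (by decide)
        have hz := hX0 Y hY (by simp) (hall X (fun f hf => (hoff f hf).1) (by simp [hYe]))
        have hz' := hX0' Y hY (by simp) (hall X' (fun f hf => (hoff f hf).2) (by simp [hYe]))
        intro f
        by_cases hf : f = e
        · subst hf
          simp
        · rw [Function.update_of_ne hf, signComp]
          split_ifs
          · exact hz' f
          · exact hz f)
    refine ⟨Z, hZ, ?_, ?_⟩
    · rw [hZf e (fun h => h.2 rfl), Function.update_self]
    · intro f hf
      have hfe : f ≠ e := fun h => hf (h ▸ he)
      rw [hZf f (fun h => hf h.1), Function.update_of_ne hfe]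

/-- The contraction `O / S`, an oriented matroid on `E \ S`: its covectors are the restrictions
to `E \ S` of the covectors of `O` that vanish on `S`. -/
def contract {E : Type*} (O : OrientedMatroid E) (S : Set E) :
    OrientedMatroid {e : E // e ∉ S} where
  covectors := {X | ∃ Y ∈ O.covectors, (∀ s ∈ S, Y s = 0) ∧ X = fun e => Y e.1}
  zero_mem := ⟨0, O.zero_mem, fun _ _ => rfl, rfl⟩
  neg_mem := by
    rintro _ ⟨Y, hY, hS, rfl⟩
    exact ⟨-Y, O.neg_mem Y hY, fun s hs => by simp [hS s hs], rfl⟩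
  comp_mem := by
    rintro _ ⟨Y, hY, hS, rfl⟩ _ ⟨Y', hY', hS', rfl⟩
    exact ⟨signComp Y Y', O.comp_mem Y hY Y' hY',
      fun s hs => by simp [signComp, hS s hs, hS' s hs], rfl⟩
  elim := by
    rintro _ ⟨Y, hY, hS, rfl⟩ _ ⟨Y', hY', hS', rfl⟩ e he
    obtain ⟨Z, hZ, hZe, hZf⟩ := O.elim Y hY Y' hY' e.1 he
    refine ⟨fun f => Z f.1, ⟨Z, hZ, fun s hs => ?_, rfl⟩, hZe, fun f hf => hZf f.1 hf⟩
    rw [hZf s (fun h => h.1 (hS s hs))]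
    simp [signComp, hS s hs, hS' s hs]

/-- `O` is totally cyclic if the all-`+` sign vector is a vector of `O`, that is, lies in `O*`. -/
def IsTotallyCyclic {E : Type*} [Finite E] (O : OrientedMatroid E) : Prop :=
  (fun _ => 1) ∈ O.dual.covectors

/-- `S` is a dijoin if it meets the support of every nonzero nonnegative covector. -/
def IsDijoin {E : Type*} (O : OrientedMatroid E) (S : Set E) : Prop :=
  ∀ Y ∈ O.covectors, Y ≠ 0 → (∀ e, 0 ≤ Y e) → (Function.support Y ∩ S).Nonempty

/-- A cocircuit is a nonzero covector of inclusion-minimal support. -/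
def IsCocircuit {E : Type*} (O : OrientedMatroid E) (Y : E → SignType) : Prop :=
  Y ∈ O.covectors ∧ Y ≠ 0 ∧
    ∀ Z ∈ O.covectors, Z ≠ 0 → Function.support Z ⊆ Function.support Y →
      Function.support Z = Function.support Y

/-- A positive cocircuit is a cocircuit without negative entries. -/
def IsPositiveCocircuit {E : Type*} (O : OrientedMatroid E) (Y : E → SignType) : Prop :=
  O.IsCocircuit Y ∧ ∀ e, 0 ≤ Y e

end OrientedMatroid

namespace OrientedMatroid

/-! The all-`+` vector is orthogonal to every covector exactly when no nonzero covector is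
nonnegative, since covectors are closed under negation (`isTotallyCyclic_iff`). Nonzero nonnegative
covectors of `O / S` are restrictions of those of `O` that vanish on `S`, which are precisely the
witnesses against `S` being a dijoin. For cocircuits, it remains to find a positive cocircuit inside
the support of any nonnegative `Y ≠ 0`; this is a descent on supports, whose step is
`exists_nonneg_support_ssubset`. -/

/-- A nonzero covector whose support is properly contained in that of a nonnegative covector
`Y` can be replaced by a nonnegative one, by repeatedly eliminating its negative entries
against `Y`. -/
theorem exists_nonneg_support_ssubset {E : Type*} [Finite E] (O : OrientedMatroid E)
    {Y : E → SignType} (hY : Y ∈ O.covectors) (hpos : ∀ e, 0 ≤ Y e)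
    {Z : E → SignType} (hZ : Z ∈ O.covectors) (hZ0 : Z ≠ 0)
    (hZY : Function.support Z ⊂ Function.support Y) :
    ∃ W ∈ O.covectors, W ≠ 0 ∧ (∀ e, 0 ≤ W e) ∧
      Function.support W ⊂ Function.support Y := by
  induction hn : {e | Z e < 0}.ncard using Nat.strong_induction_on generalizing Z with
  | _ n ih =>
    by_cases hneg : ∀ e, 0 ≤ Z e
    · exact ⟨Z, hZ, hZ0, hneg, hZY⟩
    push Not at hneg
    obtain ⟨e, he⟩ := hneg
    have hYe : Y e ≠ 0 := hZY.1 (show Z e ≠ 0 from he.ne)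
    -- As `Y` is nonnegative, separation occurs only at negative entries of `Z`, so elimination
    -- creates no new negative entries.
    have hsep : ∀ f, f ∈ signSep Y Z → Z f < 0 := by
      rintro f ⟨h1, h2⟩
      have h3 := hpos f
      revert h1 h2 h3
      generalize Y f = u
      generalize Z f = v
      revert u v
      decide
    have hes : e ∈ signSep Y Z := by
      refine ⟨hYe, ?_⟩
      have h3 := hpos e
      revert he hYe h3
      generalize Y e = u
      generalize Z e = v
      revert u v
      decide
    obtain ⟨W, hW, hWe, hWf⟩ := O.elim Y hY Z hZ e hes
    -- Properness of the inclusion is what keeps `W` nonzero: `g` is not separated, so `W` inherits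
    -- the entry of `Y` there.
    obtain ⟨g, hgY, hgZ⟩ := Set.exists_of_ssubset hZY
    have hgZ : Z g = 0 := Function.notMem_support.1 hgZ
    have hWg : W g = Y g := by
      rw [hWf g fun hs => (hsep g hs).ne hgZ, signComp, if_neg hgY]
    have hWY : Function.support W ⊆ Function.support Y := by
      intro f hf hYf
      have hZf : Z f = 0 := by
        by_contra h
        exact hZY.1 h hYf
      refine hf ?_
      rw [hWf f fun hs => hs.1 hYf, signComp, if_pos hYf, hZf]
    -- The eliminated element `e` does double duty: it lies in the support of `Y` but not of `W`,
    -- and it is a negative entry of `Z` that `W` loses.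
    refine ih _ ?_ hW (fun h => hgY ?_) ⟨hWY, fun h => h hYe hWe⟩ rfl
    · rw [← hn]
      refine Set.ncard_lt_ncard ⟨fun f hf => ?_, fun h => ?_⟩ (Set.toFinite _)
      · by_contra hZf
        have hf' : W f < 0 := hf
        rw [hWf f fun hs => hZf (hsep f hs), signComp] at hf'
        split_ifs at hf'
        · exact hZf hf'
        · exact absurd hf' (hpos f).not_gt
      · have h' : W e < 0 := h he
        exact h'.ne hWe
    · rw [← hWg, h, Pi.zero_apply]

/-- The support of every nonzero nonnegative covector contains that of a positive cocircuit. -/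
theorem exists_isPositiveCocircuit_support_subset {E : Type*} [Finite E] (O : OrientedMatroid E)
    {Y : E → SignType} (hY : Y ∈ O.covectors) (hY0 : Y ≠ 0) (hpos : ∀ e, 0 ≤ Y e) :
    ∃ X, O.IsPositiveCocircuit X ∧ Function.support X ⊆ Function.support Y := by
  induction hn : (Function.support Y).ncard using Nat.strong_induction_on generalizing Y with
  | _ n ih =>
    by_cases hc : O.IsCocircuit Y
    · exact ⟨Y, ⟨hc, hpos⟩, subset_rfl⟩
    have : ∃ Z ∈ O.covectors, Z ≠ 0 ∧ Function.support Z ⊂ Function.support Y := by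
      by_contra h
      push Not at h
      exact hc ⟨hY, hY0, fun Z hZ hZ0 hZY => by
        by_contra hne
        exact h Z hZ hZ0 (hZY.ssubset_of_ne hne)⟩
    obtain ⟨Z, hZ, hZ0, hZY⟩ := this
    obtain ⟨W, hW, hW0, hWpos, hWY⟩ := O.exists_nonneg_support_ssubset hY hpos hZ hZ0 hZY
    obtain ⟨X, hX, hXW⟩ :=
      ih _ (hn ▸ Set.ncard_lt_ncard hWY (Set.toFinite _)) hW hW0 hWpos rfl
    exact ⟨X, hX, hXW.trans hWY.1⟩

/-- An oriented matroid is totally cyclic iff it has no nonzero nonnegative covector. -/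
theorem isTotallyCyclic_iff {E : Type*} [Finite E] (O : OrientedMatroid E) :
    O.IsTotallyCyclic ↔ ∀ Y ∈ O.covectors, (∀ e, 0 ≤ Y e) → Y = 0 := by
  -- With the empty set the vanishing condition is vacuous, and the products with the all-`+` vector
  -- are the entries of `Y` themselves.
  have h := orth_covectors_iff O (fun _ => 1) ∅
  simp only [Set.mem_empty_iff_false, false_imp_iff, implies_true, true_imp_iff, one_mul] at h
  simp only [funext_iff, Pi.zero_apply]
  exact h

/-- A covector vanishing on `S` is determined by its restriction to the complement, so restriction
preserves and reflects being zero and being nonnegative. -/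
theorem isDijoin_iff_isTotallyCyclic_contract {E : Type*} [Finite E] (O : OrientedMatroid E)
    (S : Set E) : O.IsDijoin S ↔ (O.contract S).IsTotallyCyclic := by
  rw [isTotallyCyclic_iff]
  constructor
  · rintro h _ ⟨Y, hY, hS, rfl⟩ hpos
    have hY0 : Y = 0 := by
      by_contra hY0
      obtain ⟨s, hsY, hs⟩ := h Y hY hY0 fun e => by
        by_cases he : e ∈ S
        · exact (hS e he).ge
        · exact hpos ⟨e, he⟩
      exact hsY (hS s hs)
    subst hY0
    rfl
  · intro h Y hY hY0 hpos
    by_contra hne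
    have hS : ∀ s ∈ S, Y s = 0 := fun s hs => by
      by_contra hsY
      exact hne ⟨s, hsY, hs⟩
    have hr := h _ ⟨Y, hY, hS, rfl⟩ fun e => hpos e.1
    refine hY0 (funext fun e => ?_)
    by_cases he : e ∈ S
    · exact hS e he
    · exact congrFun hr ⟨e, he⟩

/-- It suffices to test the dijoin property on positive cocircuits. -/
theorem isDijoin_iff_forall_isPositiveCocircuit {E : Type*} [Finite E] (O : OrientedMatroid E)
    (S : Set E) : O.IsDijoin S ↔
      ∀ Y : E → SignType, O.IsPositiveCocircuit Y → (Function.support Y ∩ S).Nonempty := by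
  constructor
  · exact fun h Y hY => h Y hY.1.1 hY.1.2.1 hY.2
  · intro h Y hY hY0 hpos
    obtain ⟨X, hX, hXY⟩ := O.exists_isPositiveCocircuit_support_subset hY hY0 hpos
    exact (h X hX).mono (Set.inter_subset_inter_left S hXY)

end OrientedMatroid

theorem mainTheorem12 {E : Type*} [Finite E] (O : OrientedMatroid E) (S : Set E) :
    (O.IsDijoin S ↔ (O.contract S).IsTotallyCyclic) ∧
    ((∀ Y : E → SignType, O.IsPositiveCocircuit Y → (Function.support Y ∩ S).Nonempty) ↔
      (O.contract S).IsTotallyCyclic) :=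
  ⟨O.isDijoin_iff_isTotallyCyclic_contract S,
    (O.isDijoin_iff_forall_isPositiveCocircuit S).symm.trans
      (O.isDijoin_iff_isTotallyCyclic_contract S)⟩
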